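/- Fix $\nu,\alpha,\beta,\sigma^2>0$ and an integer $d\ge 1$. For $\phi,\tau^2>0$ let $$\mathcal M(h;\nu,\phi,\tau^2)=\tau^2\,\frac{2^{1-\nu}}{\Gamma(\nu)}\Big(\frac{\sqrt{2\nu}}{\phi}h\Big)^{\nu}\mathcal K_\nu\Big(\frac{\sqrt{2\nu}}{\phi}h\Big)\quad (h>0),\qquad \mathcal M(0;\nu,\phi,\tau^2)=\tau^2,$$ be the Matérn covariance function, where $\mathcal K_\nu$ is the modified Bessel function of the second kind. The Confluent Hypergeometric (CH) covariance function is the mixture of Matérn covariances over an inverse gamma distribution for $\phi^2$ with shape $\alpha$ and scale $\beta^2/2$: $$C(h)=C(h;\nu,\alpha,\beta,\sigma^2)=\int_0^\infty \mathcal M(h;\nu,\sqrt v,\sigma^2)\,\frac{(\beta^2/2)^{\alpha}}{\Gamma(\alpha)}\,v^{-\alpha-1}e^{-\beta^2/(2v)}\,dv,\qquad h\ge 0.$$ **(a) Origin behavior.** The differentiability of the CH class is controlled by $\nu$ alone, in the same way as for the Matérn class. That is, for each of the functions $F=C(\cdot\,;\nu,\alpha,\beta,\sigma^2)$ and $F=\mathcal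 M(\cdot\,;\nu,\phi,\tau^2)$ (with any $\phi,\tau^2>0$) and for every integer $m\ge 0$: - the even function $h\mapsto F(|h|)$ on $\mathbb R$ is $2m$ times differentiable at $h=0$ if and only if $m<\nu$; - if $Z$ is a square-integrable random field on $\mathbb R^d$ with constant mean and with $\operatorname{cov}(Z(\mathbf s),Z(\mathbf t))=F(|\mathbf s-\mathbf t|)$ for all $\mathbf s,\mathbf t$, then $Z$ is $m$ times mean-square differentiable (all iterated mean-square directional derivatives of order at most $m$ exist) if and only if $m<\nu$; also, for every fixed direction $\mathbf e\neq 0$, $Z$ is $m$ times mean-square differentiable in the direction $\mathbf e$ if and only if $m<\nu$. In particular, if $\nu$ is not an integer, such a field is exactly $\lfloor\nu\rfloor$ times mean-square differentiable. **(b) Tail behavior.** The function $L(x)=\{x/(x+\beta^2/(2\nu))\}^{\nu+\alpha}$ is slowly varying at $\infty$, and $$C(h;\nu,\alpha,\beta,\sigma^2)\sim\frac{\sigma^2\beta^{2\alpha}\,\Gamma(\nu+\alpha)}{\nu^{\alpha}\,\Gamma(\nu)}\,|h|^{-2\alpha}L(h^2)\qquad\text{as } h\to\infty,$$ i.e. the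 ratio of the two sides tends to $1$. -/

import Mathlib

open Real Set Filter Topology MeasureTheory ProbabilityTheory Asymptotics
open scoped ENNReal

universe u

noncomputable section

/-! ### Covariance functions -/

/-- The modified Bessel function of the second kind, for real order `p` and argument `z > 0`:
`K_p(z) = ½ ∫₀^∞ x^(p-1) exp(-z (x + 1/x) / 2) dx`. -/
def besselK (p z : ℝ) : ℝ :=
  (1 / 2) * ∫ x in Ioi (0 : ℝ), x ^ (p - 1) * exp (-(z * (x + 1 / x)) / 2)

/-- The Matérn covariance at distance `h ≥ 0`, with smoothness `ν`, range `φ` and variance `σsq`.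
At `h = 0` it has the value `σsq`, which is the limit of the formula as `h → 0+`. -/
def maternCov (ν φ σsq h : ℝ) : ℝ :=
  if h = 0 then σsq
  else σsq * ((2 : ℝ) ^ (1 - ν) / Gamma ν) * (√(2 * ν) / φ * h) ^ ν *
    besselK ν (√(2 * ν) / φ * h)

/-- The density at `x > 0` of the inverse gamma distribution with shape `a` and scale `b`. -/
def invGammaDensity (a b x : ℝ) : ℝ :=
  b ^ a / Gamma a * x ^ (-a - 1) * exp (-b / x)

/-- The Confluent Hypergeometric (CH) covariance at distance `h ≥ 0`, with smoothness `ν`, tail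
decay `α`, scale `β` and variance `σsq`: the Matérn covariance with `φ²` (the variable `v` below)
mixed over the inverse gamma distribution with shape `α` and scale `β² / 2`. -/
def chCov (ν α β σsq h : ℝ) : ℝ :=
  ∫ v in Ioi (0 : ℝ), maternCov ν (√v) σsq h * invGammaDensity α (β ^ 2 / 2) v

/-! ### Differentiability of a function of one variable at a point -/

/-- `f` is `k` times differentiable at `x`: for `k = j + 1`, it is `j` times differentiable at
all points near `x`, and its `j`-th derivative is differentiable at `x`. -/
def TimesDifferentiableAt : ℕ → (ℝ → ℝ) → ℝ → Prop
  | 0, _, _ => True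
  | k + 1, f, x =>
      (∀ᶠ y in 𝓝 x, TimesDifferentiableAt k f y) ∧ DifferentiableAt ℝ (iteratedDeriv k f) x

/-! ### Random fields and mean-square differentiability -/

/-- `Z` is a square-integrable random field on `ℝ^d` with constant mean and with the isotropic
covariance `cov(Z(s), Z(t)) = C(|s - t|)`. -/
structure IsIsotropicField {d : ℕ} {Ω : Type u} [MeasurableSpace Ω] (P : Measure Ω)
    (Z : EuclideanSpace ℝ (Fin d) → Ω → ℝ) (C : ℝ → ℝ) : Prop where
  memLp : ∀ s, MemLp (Z s) 2 P
  mean : ∃ c : ℝ, ∀ s, ∫ ω, Z s ω ∂P = c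
  cov : ∀ s t, covariance (Z s) (Z t) P = C ‖s - t‖

/-- The field `Z'` is the mean-square derivative of the field `Z` in the direction `u`: at every
`s`, `(Z(s + t u) - Z(s)) / t → Z'(s)` in mean square as `t → 0`. -/
def HasMSDerivAlong {d : ℕ} {Ω : Type u} [MeasurableSpace Ω] (P : Measure Ω)
    (Z Z' : EuclideanSpace ℝ (Fin d) → Ω → ℝ) (u : EuclideanSpace ℝ (Fin d)) : Prop :=
  ∀ s, Tendsto (fun t : ℝ => eLpNorm (fun ω => (Z (s + t • u) ω - Z s ω) / t - Z' s ω) 2 P)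
    (𝓝[≠] 0) (𝓝 0)

/-- `Z` is `m` times mean-square differentiable: all its iterated mean-square directional
derivatives of order up to `m` exist (in arbitrary, possibly different, directions). -/
def IsMSDifferentiable {d : ℕ} {Ω : Type u} [MeasurableSpace Ω] (P : Measure Ω) :
    ℕ → (EuclideanSpace ℝ (Fin d) → Ω → ℝ) → Prop
  | 0, Z => ∀ s, MemLp (Z s) 2 P
  | m + 1, Z => (∀ s, MemLp (Z s) 2 P) ∧
      ∀ u, ∃ Z', HasMSDerivAlong P Z Z' u ∧ IsMSDifferentiable P m Z'

/-- `Z` is `m` times mean-square differentiable in the single direction `u`. -/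
def IsMSDifferentiableAlong {d : ℕ} {Ω : Type u} [MeasurableSpace Ω] (P : Measure Ω)
    (u : EuclideanSpace ℝ (Fin d)) : ℕ → (EuclideanSpace ℝ (Fin d) → Ω → ℝ) → Prop
  | 0, Z => ∀ s, MemLp (Z s) 2 P
  | m + 1, Z => (∀ s, MemLp (Z s) 2 P) ∧
      ∃ Z', HasMSDerivAlong P Z Z' u ∧ IsMSDifferentiableAlong P u m Z'

/-! ### Slow variation -/

/-- `L` is slowly varying at `∞`: it is positive and measurable on some `[a, ∞)`, and
`L(t x) / L(x) → 1` as `x → ∞` for every `t > 0`. -/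
def IsSlowlyVarying (L : ℝ → ℝ) : Prop :=
  (∃ a : ℝ, (∀ x, a ≤ x → 0 < L x) ∧ Measurable ((Ici a).domRestrict L)) ∧
    ∀ t : ℝ, 0 < t → Tendsto (fun x => L (t * x) / L x) atTop (𝓝 1)

/-- The function `L(x) = {x / (x + β² / (2ν))}^(ν + α)`. -/
def chSlow (ν α β x : ℝ) : ℝ :=
  (x / (x + β ^ 2 / (2 * ν))) ^ (ν + α)

end

/-!
The Matérn and the CH covariances are scale mixtures of Gaussian covariances: both have the form
`F h = σ² 𝔼[exp (-X h²)]`, where `X = ν / (2 φ² S)` in the Matérn case and `X = ν T / (2 S)` in the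
CH case, for independent `S ∼ Gamma(ν, 1)` and `T ∼ Gamma(α, β² / 2)`. In both cases `𝔼[X ^ m] < ∞`
if and only if `m < ν`.

Origin: `F ‖·‖` is `σ²` times the characteristic function of `√(2 X) g` with `g` standard Gaussian,
so the spectral measure has a finite moment of order `2m` in a direction `u ≠ 0` if and only if
`𝔼[X ^ m] < ∞`. A finite second spectral moment is equivalent to the convergence of the difference
quotients of the field and to twice differentiability of the covariance at `0`: dominated
convergence in one direction, Fatou's lemma in the other. A derivative in the direction `u`
multiplies the spectral measure by `⟪·, u⟫ ^ 2`, which makes an induction on `m` possible.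

Tail: integrating out `T` gives `C h = σ² 𝔼[(b / (b + h² ν / (2 S))) ^ α]` with `b = β² / 2`. By
dominated convergence `h ^ (2 α) C h` tends to `σ² (β² / ν) ^ α 𝔼[S ^ α]`.
-/

/-! ### Integrability from limits and bounds -/

lemma integrable_of_tendsto_integral {Θ ι : Type*} [MeasurableSpace Θ] {μ : Measure Θ}
    {l : Filter ι} [l.NeBot] [l.IsCountablyGenerated] {G : ι → Θ → ℝ} {f : Θ → ℝ} {c : ℝ}
    (hGm : ∀ i, Measurable (G i)) (hG : ∀ i, Integrable (G i) μ) (hG0 : ∀ i, 0 ≤ G i)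
    (hf : Measurable f) (hlim : ∀ θ, Tendsto (G · θ) l (𝓝 (f θ)))
    (h : Tendsto (fun i => ∫ θ, G i θ ∂μ) l (𝓝 c)) : Integrable f μ := by
  refine ⟨hf.aestronglyMeasurable, lt_of_le_of_lt ?_ (ENNReal.ofReal_lt_top (r := c))⟩
  calc ∫⁻ θ, ‖f θ‖ₑ ∂μ
      = ∫⁻ θ, liminf (fun i => ‖G i θ‖ₑ) l ∂μ :=
        lintegral_congr fun θ => (hlim θ).enorm.liminf_eq.symm
    _ ≤ liminf (fun i => ∫⁻ θ, ‖G i θ‖ₑ ∂μ) l := lintegral_liminf_le fun i => (hGm i).enorm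
    _ = liminf (fun i => ENNReal.ofReal (∫ θ, G i θ ∂μ)) l := by
        congr 1 with i
        rw [ofReal_integral_eq_lintegral_ofReal (hG i) (Eventually.of_forall (hG0 i))]
        exact lintegral_congr fun θ => Real.enorm_of_nonneg (hG0 i θ)
    _ = ENNReal.ofReal c := (ENNReal.tendsto_ofReal h).liminf_eq

lemma integrable_exp_mul_of_nonpos_of_nonneg {Λ : Type*} [MeasurableSpace Λ] {ρ : Measure Λ}
    [IsFiniteMeasure ρ] {X : Λ → ℝ} (hX : AEMeasurable X ρ) (hX0 : 0 ≤ᵐ[ρ] X) {t : ℝ} (ht : t ≤ 0) :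
    Integrable (fun l => exp (t * X l)) ρ := by
  refine .of_bound (by fun_prop) 1 ?_
  filter_upwards [hX0] with l hl
  rw [norm_of_nonneg (exp_pos _).le, exp_le_one_iff]
  exact mul_nonpos_of_nonpos_of_nonneg ht hl

/-! ### Measures with a squared density -/

section SqDensity

variable {E : Type*} [MeasurableSpace E] {μ : Measure E} {w : E → ℝ}

/-- The measure with density `w ^ 2` with respect to `μ`. Differentiating a field in a direction
`u` turns its spectral measure `μ` into `sqDensity μ ⟪·, u⟫`. -/
noncomputable def sqDensity (μ : Measure E) (w : E → ℝ) : Measure E :=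
  μ.withDensity fun x => ENNReal.ofReal (w x ^ 2)

lemma integrable_sqDensity_iff (hw : Measurable w) {g : E → ℝ} :
    Integrable g (sqDensity μ w) ↔ Integrable (fun x => w x ^ 2 * g x) μ := by
  rw [sqDensity, integrable_withDensity_iff_integrable_smul' (by fun_prop) (by simp)]
  simp only [ENNReal.toReal_ofReal (sq_nonneg _), smul_eq_mul]

lemma integral_sqDensity {G : Type*} [NormedAddCommGroup G] [NormedSpace ℝ G] (hw : Measurable w)
    (g : E → G) : ∫ x, g x ∂sqDensity μ w = ∫ x, w x ^ 2 • g x ∂μ := by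
  rw [sqDensity, integral_withDensity_eq_integral_toReal_smul (by fun_prop) (by simp)]
  simp only [ENNReal.toReal_ofReal (sq_nonneg _)]

lemma isFiniteMeasure_sqDensity (h : Integrable (fun x => w x ^ 2) μ) :
    IsFiniteMeasure (sqDensity μ w) :=
  isFiniteMeasure_withDensity_ofReal h.2

end SqDensity

/-! ### Difference quotients of plane waves -/

section ExpSlope

open scoped ComplexConjugate

/-- The difference quotient between `0` and `a` of the plane wave `a ↦ exp (i a y)`. -/
noncomputable def expSlope (a y : ℝ) : ℂ :=
  (Complex.exp (Complex.I * (a * y : ℝ)) - 1) / a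

@[fun_prop]
lemma continuous_expSlope (a : ℝ) : Continuous (expSlope a) := by
  unfold expSlope
  fun_prop

lemma norm_expSlope_le (a y : ℝ) : ‖expSlope a y‖ ≤ |y| := by
  rcases eq_or_ne a 0 with rfl | ha
  · simp [expSlope]
  rw [expSlope, norm_div, Complex.norm_real, Real.norm_eq_abs, div_le_iff₀ (abs_pos.2 ha),
    ← abs_mul, mul_comm y]
  exact norm_exp_I_mul_ofReal_sub_one_le

lemma tendsto_expSlope (y : ℝ) : Tendsto (expSlope · y) (𝓝[≠] 0) (𝓝 (Complex.I * y)) := by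
  have h : HasDerivAt (fun a : ℝ => Complex.exp (Complex.I * (a * y : ℝ))) (Complex.I * y) 0 := by
    simpa using (((hasDerivAt_id (0 : ℝ)).mul_const y).ofReal_comp.const_mul Complex.I).cexp
  refine h.tendsto_slope_zero.congr fun a => ?_
  simp [expSlope, div_eq_inv_mul]

lemma norm_expSlope_sq (a y : ℝ) : ‖expSlope a y‖ ^ 2 = 2 / a ^ 2 * (1 - cos (a * y)) := by
  have hcos : cos (a * y) = 1 - 2 * sin (a * y / 2) ^ 2 := by
    rw [show a * y = 2 * (a * y / 2) by ring, cos_two_mul, cos_sq']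
    ring_nf
  rw [expSlope, norm_div, div_pow, Complex.norm_exp_I_mul_ofReal_sub_one, Real.norm_eq_abs, sq_abs,
    Complex.norm_real, Real.norm_eq_abs, sq_abs, hcos]
  ring

lemma exp_mul_expSlope_mul_conj (a b c y : ℝ) :
    Complex.exp (c * Complex.I) * (expSlope a y * conj (expSlope b y)) =
      (a⁻¹ * b⁻¹ : ℝ) * (Complex.exp ((c + a * y - b * y : ℝ) * Complex.I) -
        Complex.exp ((c + a * y : ℝ) * Complex.I) -
        (Complex.exp ((c - b * y : ℝ) * Complex.I) - Complex.exp (c * Complex.I))) := by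
  simp only [expSlope, map_div₀, map_sub, map_one, ← Complex.exp_conj, map_mul, Complex.conj_I,
    Complex.conj_ofReal, Complex.ofReal_sub, Complex.ofReal_add, Complex.ofReal_mul,
    Complex.ofReal_inv, sub_mul, add_mul, Complex.exp_add, Complex.exp_sub, neg_mul,
    Complex.exp_neg]
  field_simp

lemma integrable_norm_expSlope_sq {Θ : Type*} [MeasurableSpace Θ] {μ : Measure Θ}
    [IsFiniteMeasure μ] {Y : Θ → ℝ} (hY : Measurable Y) (a : ℝ) :
    Integrable (fun θ => ‖expSlope a (Y θ)‖ ^ 2) μ := by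
  refine .of_bound (by fun_prop) (2 / a ^ 2 * 2) (Eventually.of_forall fun θ => ?_)
  rw [norm_of_nonneg (sq_nonneg _), norm_expSlope_sq]
  gcongr
  linarith [neg_one_le_cos (a * Y θ)]

lemma integrable_sq_of_tendsto_integral_norm_expSlope_sq {Θ : Type*} [MeasurableSpace Θ]
    {μ : Measure Θ} [IsFiniteMeasure μ] {Y : Θ → ℝ} (hY : Measurable Y) {l : Filter ℝ} [l.NeBot]
    [l.IsCountablyGenerated] (hl : l ≤ 𝓝[≠] 0) {c : ℝ}
    (h : Tendsto (fun a => ∫ θ, ‖expSlope a (Y θ)‖ ^ 2 ∂μ) l (𝓝 c)) :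
    Integrable (fun θ => Y θ ^ 2) μ := by
  refine integrable_of_tendsto_integral (fun a => by fun_prop) (integrable_norm_expSlope_sq hY)
    (fun a θ => sq_nonneg _) (by fun_prop) (fun θ => ?_) h
  simpa using ((tendsto_expSlope (Y θ)).mono_left hl).norm.pow 2

end ExpSlope

/-! ### Characteristic functions on the line -/

section CharFunReal

variable {μ : Measure ℝ}

lemma TimesDifferentiableAt.of_succ {k : ℕ} {f : ℝ → ℝ} {x : ℝ}
    (h : TimesDifferentiableAt (k + 1) f x) : TimesDifferentiableAt k f x :=
  h.1.self_of_nhds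

lemma timesDifferentiableAt_of_contDiff {k : ℕ} {f : ℝ → ℝ} (hf : ContDiff ℝ k f) (x : ℝ) :
    TimesDifferentiableAt k f x := by
  induction k generalizing x with
  | zero => trivial
  | succ k ih =>
    exact ⟨Eventually.of_forall (ih (hf.of_le (by norm_cast; omega))),
      (hf.differentiable_iteratedDeriv k (by norm_cast; omega)).differentiableAt⟩

lemma tendsto_even_difference_quotient {f : ℝ → ℝ} (heven : ∀ x, f (-x) = f x)
    (hd : ∀ᶠ y in 𝓝 0, DifferentiableAt ℝ f y) (hdd : DifferentiableAt ℝ (deriv f) 0) :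
    Tendsto (fun t => (f t - f 0) / t ^ 2) (𝓝[>] 0) (𝓝 (deriv (deriv f) 0 / 2)) := by
  have hd0 : deriv f 0 = 0 := by
    have := deriv_comp_neg f 0
    simp only [heven, neg_zero] at this
    linarith
  have hmono : 𝓝[>] (0 : ℝ) ≤ 𝓝 0 := nhdsWithin_le_nhds
  refine HasDerivAt.lhopital_zero_nhdsGT (f' := deriv f) (g' := fun t => 2 * t) ?_ ?_ ?_ ?_ ?_ ?_
  · filter_upwards [hmono hd] with y hy using hy.hasDerivAt.sub_const _
  · exact Eventually.of_forall fun y => by simpa using hasDerivAt_pow 2 y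
  · filter_upwards [self_mem_nhdsWithin] with y hy
    exact mul_ne_zero two_ne_zero (ne_of_gt hy)
  · simpa using (hd.self_of_nhds.continuousAt.tendsto.sub_const (f 0)).mono_left hmono
  · simpa using ((continuous_pow (M := ℝ) 2).tendsto 0).mono_left hmono
  · refine (hdd.hasDerivAt.tendsto_slope_zero_right.div_const 2).congr fun t => ?_
    simp only [zero_add, hd0, smul_eq_mul]
    ring

lemma re_charFun_neg (t : ℝ) : (charFun μ (-t)).re = (charFun μ t).re := by
  rw [charFun_neg, Complex.conj_re]

variable [IsFiniteMeasure μ]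

lemma re_charFun_eq_integral_cos (t : ℝ) : (charFun μ t).re = ∫ x, cos (t * x) ∂μ := by
  have hint : Integrable (fun x : ℝ => Complex.exp (t * x * Complex.I)) μ :=
    .of_bound (by fun_prop) 1 (Eventually.of_forall fun x => by
      rw [← Complex.ofReal_mul, Complex.norm_exp_ofReal_mul_I])
  rw [charFun_apply_real, ← RCLike.re_eq_complex_re, ← integral_re hint]
  simp only [RCLike.re_eq_complex_re, ← Complex.ofReal_mul, Complex.exp_ofReal_mul_I_re]

lemma integrable_sq_of_differentiableAt_deriv_re_charFun
    (hd : ∀ᶠ y in 𝓝 0, DifferentiableAt ℝ (fun t => (charFun μ t).re) y)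
    (hdd : DifferentiableAt ℝ (deriv fun t => (charFun μ t).re) 0) :
    Integrable (fun x => x ^ 2) μ := by
  have hlim := (tendsto_even_difference_quotient re_charFun_neg hd hdd).const_mul (-2)
  refine integrable_sq_of_tendsto_integral_norm_expSlope_sq measurable_id
    (nhdsGT_le_nhdsNE 0) (hlim.congr fun t => ?_)
  have hcos : Integrable (fun x => cos (t * x)) μ :=
    .of_bound (by fun_prop) 1 (Eventually.of_forall fun x => abs_cos_le_one _)
  simp only [re_charFun_eq_integral_cos, norm_expSlope_sq]
  rw [integral_const_mul, integral_sub (integrable_const 1) hcos]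
  simp only [zero_mul, cos_zero]
  ring

lemma memLp_id_iff_integrable_pow (m : ℕ) :
    MemLp id ((2 * m : ℕ) : ℝ≥0∞) μ ↔ Integrable (fun x => x ^ (2 * m)) μ := by
  rcases eq_or_ne m 0 with rfl | hm
  · simp [measurable_id.aestronglyMeasurable]
  rw [← integrable_norm_rpow_iff (by fun_prop) (by simpa using hm) (ENNReal.natCast_ne_top _)]
  simp only [ENNReal.toReal_natCast, rpow_natCast, id, Real.norm_eq_abs, pow_mul, sq_abs]

lemma re_charFun_sqDensity_pow {m : ℕ} (h : Integrable (fun x => x ^ (2 * m)) μ) (t : ℝ) :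
    (charFun (sqDensity μ (· ^ m)) t).re =
      (-1) ^ m * iteratedDeriv (2 * m) (fun t => (charFun μ t).re) t := by
  have hmem := (memLp_id_iff_integrable_pow m).2 h
  have hre : iteratedDeriv (2 * m) (fun t => (charFun μ t).re) t =
      (iteratedDeriv (2 * m) (charFun μ) t).re :=
    DFunLike.congr_fun
      (Complex.reCLM.iteratedFDeriv_comp_left (contDiff_charFun hmem).contDiffAt le_rfl) fun _ => 1
  have hpow : (Complex.I ^ 2) ^ m = ((-1 : ℝ) ^ m : ℝ) := by simp
  rw [hre, iteratedDeriv_charFun hmem, pow_mul, hpow, Complex.re_ofReal_mul, ← mul_assoc,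
    ← mul_pow, neg_one_mul, neg_neg, one_pow, one_mul, charFun_apply_real,
    integral_sqDensity (by fun_prop)]
  simp only [Complex.real_smul, Complex.ofReal_pow, ← pow_mul, mul_comm m]

theorem timesDifferentiableAt_re_charFun_iff (m : ℕ) :
    TimesDifferentiableAt (2 * m) (fun t => (charFun μ t).re) 0 ↔
      Integrable (fun x => x ^ (2 * m)) μ := by
  refine ⟨fun h => ?_, fun h => timesDifferentiableAt_of_contDiff (Complex.reCLM.contDiff.comp
    (contDiff_charFun ((memLp_id_iff_integrable_pow m).2 h))) 0⟩
  induction m with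
  | zero => simp
  | succ m ih =>
    have hm := ih h.of_succ.of_succ
    have := isFiniteMeasure_sqDensity (μ := μ) (w := (· ^ m)) (by simpa only [← pow_mul'] using hm)
    have h2 : Integrable (fun x => x ^ 2) (sqDensity μ (· ^ m)) := by
      apply integrable_sq_of_differentiableAt_deriv_re_charFun <;>
        simp only [re_charFun_sqDensity_pow hm]
      · filter_upwards [h.1] with y hy using hy.2.const_mul _
      · rw [deriv_const_mul_field', ← iteratedDeriv_succ]
        exact h.2.const_mul _
    refine ((integrable_sqDensity_iff (by fun_prop)).1 h2).congr (Eventually.of_forall fun x => ?_)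
    ring

end CharFunReal

/-! ### Hilbert-valued fields with a spectral measure -/

section SpectralMeasure

open scoped InnerProductSpace ComplexConjugate

variable {E H : Type*} [NormedAddCommGroup E] [InnerProductSpace ℝ E] [MeasurableSpace E]
  [BorelSpace E] [SecondCountableTopology E] [NormedAddCommGroup H] [InnerProductSpace ℝ H]
  {V : E → H} {μ : Measure E} {u : E}

/-- The Gram function of the field `V` is, up to an additive constant (the squared mean of a random
field), the real part of the characteristic function of the measure `μ`. -/
def HasSpectralMeasure (V : E → H) (μ : Measure E) : Prop :=
  ∃ k : ℝ, ∀ s t, ⟪V s, V t⟫_ℝ = k + (charFun μ (s - t)).re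

/-- The isometry `V s ↦ exp (i ⟪·, s⟫)` into `L²(μ)` turns the difference quotients of `V` into
those of plane waves. -/
lemma HasSpectralMeasure.inner_difference_quotient [IsFiniteMeasure μ] (h : HasSpectralMeasure V μ)
    (s t : E) (a b : ℝ) :
    ⟪a⁻¹ • (V (s + a • u) - V s), b⁻¹ • (V (t + b • u) - V t)⟫_ℝ =
      (∫ x, Complex.exp (⟪x, s - t⟫_ℝ * Complex.I) *
        (expSlope a ⟪x, u⟫_ℝ * conj (expSlope b ⟪x, u⟫_ℝ)) ∂μ).re := by
  obtain ⟨k, hk⟩ := h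
  have hint : ∀ v : E, Integrable (fun x => Complex.exp (⟪x, v⟫_ℝ * Complex.I)) μ := fun v =>
    .of_bound (by fun_prop) 1
      (Eventually.of_forall fun x => (Complex.norm_exp_ofReal_mul_I _).le)
  have hint₂ : ∀ v w : E, Integrable (fun x => Complex.exp (⟪x, v⟫_ℝ * Complex.I) -
      Complex.exp (⟪x, w⟫_ℝ * Complex.I)) μ := fun v w => (hint v).sub (hint w)
  have hkernel : ∀ x, Complex.exp (⟪x, s - t⟫_ℝ * Complex.I) *
      (expSlope a ⟪x, u⟫_ℝ * conj (expSlope b ⟪x, u⟫_ℝ)) =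
      (a⁻¹ * b⁻¹ : ℝ) * (Complex.exp (⟪x, s + a • u - (t + b • u)⟫_ℝ * Complex.I) -
        Complex.exp (⟪x, s + a • u - t⟫_ℝ * Complex.I) -
        (Complex.exp (⟪x, s - (t + b • u)⟫_ℝ * Complex.I) -
        Complex.exp (⟪x, s - t⟫_ℝ * Complex.I))) := fun x => by
    rw [exp_mul_expSlope_mul_conj, ← real_inner_smul_right, ← real_inner_smul_right,
      ← inner_add_right, ← inner_sub_right, ← inner_sub_right]
    congr! 7 <;> abel
  rw [real_inner_smul_left, real_inner_smul_right, inner_sub_left, inner_sub_right, inner_sub_right]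
  simp only [hk, hkernel]
  rw [integral_const_mul, Complex.re_ofReal_mul, integral_sub (hint₂ _ _) (hint₂ _ _),
    integral_sub (hint _) (hint _), integral_sub (hint _) (hint _)]
  simp only [Complex.sub_re, ← charFun_apply]
  ring

/-- Dominated convergence, with bound `⟪x, u⟫ ^ 2`. -/
lemma HasSpectralMeasure.tendsto_inner_difference_quotient [IsFiniteMeasure μ]
    (h : HasSpectralMeasure V μ) (h2 : Integrable (fun x => ⟪x, u⟫_ℝ ^ 2) μ) (s t : E) :
    Tendsto (fun p : ℝ × ℝ =>
        ⟪p.1⁻¹ • (V (s + p.1 • u) - V s), p.2⁻¹ • (V (t + p.2 • u) - V t)⟫_ℝ)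
      (𝓝[≠] 0 ×ˢ 𝓝[≠] 0) (𝓝 (charFun (sqDensity μ fun x => ⟪x, u⟫_ℝ) (s - t)).re) := by
  rw [charFun_apply, integral_sqDensity (by fun_prop)]
  simp only [h.inner_difference_quotient]
  refine (Complex.continuous_re.tendsto _).comp <| tendsto_integral_filter_of_dominated_convergence
    (fun x => ⟪x, u⟫_ℝ ^ 2) (Eventually.of_forall fun p => by fun_prop)
    (Eventually.of_forall fun p => Eventually.of_forall fun x => ?_) h2
    (Eventually.of_forall fun x => ?_)
  · rw [norm_mul, Complex.norm_exp_ofReal_mul_I, one_mul, norm_mul, RCLike.norm_conj,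
      ← sq_abs, sq]
    gcongr <;> exact norm_expSlope_le _ _
  · have hslope := (tendsto_expSlope ⟪x, u⟫_ℝ)
    convert! (((hslope.comp tendsto_fst).mul ((Complex.continuous_conj.tendsto _).comp
      (hslope.comp tendsto_snd))).const_mul (Complex.exp (⟪x, s - t⟫_ℝ * Complex.I))) using 2
    simp only [map_mul, Complex.conj_I, Complex.conj_ofReal, Complex.real_smul, Complex.ofReal_pow]
    linear_combination ((⟪x, u⟫_ℝ : ℂ) ^ 2 * Complex.exp (⟪x, s - t⟫_ℝ * Complex.I)) *
      Complex.I_sq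

theorem HasSpectralMeasure.exists_hasLineDerivAt [CompleteSpace H] [IsFiniteMeasure μ]
    (h : HasSpectralMeasure V μ) (h2 : Integrable (fun x => ⟪x, u⟫_ℝ ^ 2) μ) (s : E) :
    ∃ w, HasLineDerivAt ℝ V w s u := by
  have hlim := h.tendsto_inner_difference_quotient h2 s s
  simp only [hasLineDerivAt_iff_tendsto_slope_zero]
  refine cauchy_map_iff_exists_tendsto.1 (cauchy_map_iff.2 ⟨inferInstance, ?_⟩)
  rw [tendsto_uniformity_iff_dist_tendsto_zero]
  have hsq := ((((hlim.comp (tendsto_fst.prodMk tendsto_fst)).sub (hlim.const_mul 2)).add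
    (hlim.comp (tendsto_snd.prodMk tendsto_snd)))).sqrt
  rw [two_mul, sub_add_cancel_left, neg_add_cancel, sqrt_zero] at hsq
  refine hsq.congr fun p => ?_
  rw [dist_eq_norm, ← sqrt_sq (norm_nonneg _), norm_sub_sq_real]
  simp only [Function.comp, real_inner_self_eq_norm_sq]

theorem HasSpectralMeasure.integrable_of_hasLineDerivAt [IsFiniteMeasure μ]
    (h : HasSpectralMeasure V μ) {s : E} {w : H} (hw : HasLineDerivAt ℝ V w s u) :
    Integrable (fun x => ⟪x, u⟫_ℝ ^ 2) μ := by
  have hA := hasLineDerivAt_iff_tendsto_slope_zero.1 hw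
  refine integrable_sq_of_tendsto_integral_norm_expSlope_sq (by fun_prop) le_rfl
    ((hA.inner (𝕜 := ℝ) hA).congr fun a => ?_)
  simp only [h.inner_difference_quotient, sub_self, inner_zero_right, Complex.ofReal_zero,
    zero_mul, Complex.exp_zero, one_mul, Complex.mul_conj, Complex.normSq_eq_norm_sq]
  rw [integral_complex_ofReal, Complex.ofReal_re]

theorem HasSpectralMeasure.lineDeriv [IsFiniteMeasure μ] (h : HasSpectralMeasure V μ) {W : E → H}
    (hW : ∀ s, HasLineDerivAt ℝ V (W s) s u) :
    HasSpectralMeasure W (sqDensity μ fun x => ⟪x, u⟫_ℝ) := by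
  have h2 := h.integrable_of_hasLineDerivAt (hW 0)
  simp only [hasLineDerivAt_iff_tendsto_slope_zero] at hW
  refine ⟨0, fun s t => ?_⟩
  rw [zero_add]
  exact tendsto_nhds_unique ((hW s).inner (hW t))
    ((h.tendsto_inner_difference_quotient h2 s t).comp (tendsto_id.prodMk tendsto_id))

end SpectralMeasure

/-! ### Mean-square differentiability -/

section RandomField

open scoped InnerProductSpace

variable {d : ℕ} {Ω : Type u} [MeasurableSpace Ω] {P : Measure Ω}
  {Z Z' : EuclideanSpace ℝ (Fin d) → Ω → ℝ} {u : EuclideanSpace ℝ (Fin d)}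
  {μ : Measure (EuclideanSpace ℝ (Fin d))}

lemma inner_toLp_toLp {f g : Ω → ℝ} (hf : MemLp f 2 P) (hg : MemLp g 2 P) :
    ⟪hf.toLp f, hg.toLp g⟫_ℝ = ∫ ω, f ω * g ω ∂P := by
  rw [L2.inner_def]
  refine integral_congr_ae ?_
  filter_upwards [hf.coeFn_toLp, hg.coeFn_toLp] with ω h1 h2
  rw [h1, h2, RCLike.inner_apply, conj_trivial, mul_comm]

lemma hasMSDerivAlong_iff_hasLineDerivAt (hZ : ∀ s, MemLp (Z s) 2 P) (hZ' : ∀ s, MemLp (Z' s) 2 P) :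
    HasMSDerivAlong P Z Z' u ↔
      ∀ s, HasLineDerivAt ℝ (fun s => (hZ s).toLp (Z s)) ((hZ' s).toLp (Z' s)) s u := by
  refine forall_congr' fun s => ?_
  have hquot : ∀ a : ℝ, MemLp (a⁻¹ • (Z (s + a • u) - Z s)) 2 P := fun a =>
    ((hZ (s + a • u)).sub (hZ s)).const_smul a⁻¹
  have hlim := Lp.tendsto_Lp_iff_tendsto_eLpNorm'' (fi := 𝓝[≠] (0 : ℝ)) _ hquot (Z' s) (hZ' s)
  have htoLp : ∀ a, (hquot a).toLp _ =
      a⁻¹ • ((hZ (s + a • u)).toLp (Z (s + a • u)) - (hZ s).toLp (Z s)) := fun a => by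
    rw [← MemLp.toLp_sub, ← MemLp.toLp_const_smul]
  simp only [htoLp] at hlim
  rw [hasLineDerivAt_iff_tendsto_slope_zero, hlim]
  refine tendsto_congr fun a => ?_
  congr 1 with ω
  simp [div_eq_inv_mul]

lemma IsIsotropicField.hasSpectralMeasure [IsProbabilityMeasure P] {F : ℝ → ℝ}
    (h : IsIsotropicField P Z F) (hF : ∀ v, F ‖v‖ = (charFun μ v).re) :
    HasSpectralMeasure (fun s => (h.memLp s).toLp (Z s)) μ := by
  obtain ⟨c, hc⟩ := h.mean
  refine ⟨c * c, fun s t => ?_⟩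
  have hcov := covariance_eq_sub (h.memLp s) (h.memLp t)
  rw [h.cov, hc, hc, hF] at hcov
  rw [inner_toLp_toLp, hcov, add_sub_cancel]
  rfl

lemma integrable_inner_sq_mul_norm_pow {k : ℕ} (h : Integrable (fun x => ‖x‖ ^ (k + 2)) μ) :
    Integrable (fun x => ⟪x, u⟫_ℝ ^ 2 * ‖x‖ ^ k) μ := by
  refine (h.const_mul (‖u‖ ^ 2)).mono' (by fun_prop) (Eventually.of_forall fun x => ?_)
  rw [norm_of_nonneg (by positivity)]
  calc ⟪x, u⟫_ℝ ^ 2 * ‖x‖ ^ k ≤ (‖x‖ * ‖u‖) ^ 2 * ‖x‖ ^ k := by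
        rw [← sq_abs]
        gcongr
        exact abs_real_inner_le_norm x u
    _ = ‖u‖ ^ 2 * ‖x‖ ^ (k + 2) := by ring

variable [IsFiniteMeasure μ]

lemma HasSpectralMeasure.exists_hasMSDerivAlong (hZ : ∀ s, MemLp (Z s) 2 P)
    (h : HasSpectralMeasure (fun s => (hZ s).toLp (Z s)) μ)
    (h2 : Integrable (fun x => ⟪x, u⟫_ℝ ^ 2) μ) :
    ∃ Z', (∀ s, MemLp (Z' s) 2 P) ∧ HasMSDerivAlong P Z Z' u := by
  choose W hW using h.exists_hasLineDerivAt h2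
  refine ⟨fun s => W s, fun s => Lp.memLp (W s), ?_⟩
  rw [hasMSDerivAlong_iff_hasLineDerivAt hZ fun s => Lp.memLp (W s)]
  simpa only [Lp.toLp_coeFn] using hW

theorem HasSpectralMeasure.isMSDifferentiable (m : ℕ) (hZ : ∀ s, MemLp (Z s) 2 P)
    (h : HasSpectralMeasure (fun s => (hZ s).toLp (Z s)) μ)
    (hm : Integrable (fun x => ‖x‖ ^ (2 * m)) μ) : IsMSDifferentiable P m Z := by
  induction m generalizing μ Z with
  | zero => exact hZ
  | succ m ih =>
    refine ⟨hZ, fun u => ?_⟩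
    have h2 : Integrable (fun x => ⟪x, u⟫_ℝ ^ 2) μ := by
      simpa using integrable_inner_sq_mul_norm_pow (k := 0)
        (integrable_norm_pow_of_le (by fun_prop) (by omega) hm)
    have := isFiniteMeasure_sqDensity h2
    obtain ⟨Z', hZ', hderiv⟩ := h.exists_hasMSDerivAlong hZ h2
    exact ⟨Z', hderiv, ih hZ' (h.lineDeriv ((hasMSDerivAlong_iff_hasLineDerivAt hZ hZ').1 hderiv))
      ((integrable_sqDensity_iff (by fun_prop)).2 (integrable_inner_sq_mul_norm_pow hm))⟩

lemma IsMSDifferentiableAlong.memLp {m : ℕ} (h : IsMSDifferentiableAlong P u m Z) :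
    ∀ s, MemLp (Z s) 2 P := by
  cases m with
  | zero => exact h
  | succ m => exact h.1

theorem HasSpectralMeasure.integrable_inner_pow (m : ℕ) (hZ : ∀ s, MemLp (Z s) 2 P)
    (h : HasSpectralMeasure (fun s => (hZ s).toLp (Z s)) μ) (hm : IsMSDifferentiableAlong P u m Z) :
    Integrable (fun x => ⟪x, u⟫_ℝ ^ (2 * m)) μ := by
  induction m generalizing μ Z with
  | zero => simp
  | succ m ih =>
    obtain ⟨-, Z', hderiv, hm'⟩ := hm
    have hline := (hasMSDerivAlong_iff_hasLineDerivAt hZ hm'.memLp).1 hderiv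
    have := isFiniteMeasure_sqDensity (h.integrable_of_hasLineDerivAt (hline 0))
    refine ((integrable_sqDensity_iff (by fun_prop)).1
      (ih hm'.memLp (h.lineDeriv hline) hm')).congr (Eventually.of_forall fun x => ?_)
    ring

lemma IsMSDifferentiable.along {m : ℕ} (h : IsMSDifferentiable P m Z)
    (u : EuclideanSpace ℝ (Fin d)) : IsMSDifferentiableAlong P u m Z := by
  induction m generalizing Z with
  | zero => exact h
  | succ m ih =>
    obtain ⟨Z', hderiv, hm⟩ := h.2 u
    exact ⟨h.1, Z', hderiv, ih hm⟩

end RandomField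

/-! ### Gaussian scale mixtures -/

section GaussianMixture

open scoped InnerProductSpace

variable {Λ : Type*} [MeasurableSpace Λ] {ρ : Measure Λ} {X : Λ → ℝ}
  {E : Type*} [NormedAddCommGroup E] [InnerProductSpace ℝ E] [FiniteDimensional ℝ E]
  [MeasurableSpace E] [BorelSpace E]

variable (ρ X E) in
/-- The Gaussian scale mixture: the law of `√(2 X) g`, where `X` is distributed according to `ρ` and
`g` is an independent standard Gaussian vector. The factor `2` makes `exp (-X ‖v‖ ^ 2)` the
characteristic function at `v`, given `X`. -/
noncomputable def gaussianMixture : Measure E :=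
  (ρ.prod (stdGaussian E)).map fun θ => √(2 * X θ.1) • θ.2

instance [IsFiniteMeasure ρ] : IsFiniteMeasure (gaussianMixture ρ X E) := by
  unfold gaussianMixture
  infer_instance

lemma integrable_gaussianMixture_iff (hX : Measurable X) {f : E → ℝ} (hf : Measurable f) :
    Integrable f (gaussianMixture ρ X E) ↔
      Integrable (fun θ => f (√(2 * X θ.1) • θ.2)) (ρ.prod (stdGaussian E)) :=
  integrable_map_measure hf.aestronglyMeasurable (by fun_prop)

lemma charFun_gaussianMixture [IsFiniteMeasure ρ] (hX : Measurable X) (hX0 : 0 ≤ᵐ[ρ] X) (v : E) :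
    charFun (gaussianMixture ρ X E) v = mgf X ρ (-‖v‖ ^ 2) := by
  rw [charFun_apply, gaussianMixture, integral_map (by fun_prop) (by fun_prop), integral_prod, mgf,
    ← integral_complex_ofReal]
  · refine integral_congr_ae ?_
    filter_upwards [hX0] with l hl
    simp only [real_inner_smul_left, ← real_inner_smul_right]
    rw [← charFun_apply, charFun_stdGaussian, norm_smul, norm_of_nonneg (sqrt_nonneg _)]
    norm_cast
    rw [mul_pow, sq_sqrt (mul_nonneg zero_le_two hl)]
    ring_nf
  · exact .of_bound (by fun_prop) 1
      (Eventually.of_forall fun θ => (Complex.norm_exp_ofReal_mul_I _).le)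

lemma integrable_norm_pow_stdGaussian (n : ℕ) :
    Integrable (fun g => ‖g‖ ^ n) (stdGaussian E) :=
  (IsGaussian.memLp_id (stdGaussian E) n (by simp)).integrable_norm_pow'

lemma frequently_inner_ne_zero_stdGaussian {u : E} (hu : u ≠ 0) :
    ∃ᵐ g ∂(stdGaussian E), ⟪g, u⟫_ℝ ≠ 0 := by
  intro h
  have hchar : charFun (stdGaussian E) u = ∫ _, 1 ∂(stdGaussian E) := by
    rw [charFun_apply]
    refine integral_congr_ae ?_
    filter_upwards [h] with g hg
    simp [not_not.1 hg]
  rw [charFun_stdGaussian, integral_const, probReal_univ, one_smul] at hchar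
  norm_cast at hchar
  simp [hu] at hchar

lemma integrable_norm_pow_gaussianMixture (hX : Measurable X) (hX0 : 0 ≤ᵐ[ρ] X) {m : ℕ}
    (hm : Integrable (fun l => X l ^ m) ρ) :
    Integrable (fun x => ‖x‖ ^ (2 * m)) (gaussianMixture ρ X E) := by
  rw [integrable_gaussianMixture_iff hX (by fun_prop)]
  refine ((hm.const_mul (2 ^ m)).mul_prod (integrable_norm_pow_stdGaussian (E := E) (2 * m))).congr
    ?_
  filter_upwards [Measure.quasiMeasurePreserving_fst.ae hX0] with θ hθ
  rw [norm_smul, mul_pow, norm_of_nonneg (sqrt_nonneg _), pow_mul √_,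
    sq_sqrt (mul_nonneg zero_le_two hθ), mul_pow]

lemma integrable_pow_of_integrable_inner_pow_gaussianMixture [SFinite ρ] (hX : Measurable X)
    (hX0 : 0 ≤ᵐ[ρ] X) {m : ℕ} {u : E} (hu : u ≠ 0)
    (h : Integrable (fun x => ⟪x, u⟫_ℝ ^ (2 * m)) (gaussianMixture ρ X E)) :
    Integrable (fun l => X l ^ m) ρ := by
  rw [integrable_gaussianMixture_iff hX (by fun_prop)] at h
  obtain ⟨g, hg0, hg⟩ := ((frequently_inner_ne_zero_stdGaussian hu).and_eventually
    h.prod_left_ae).exists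
  refine (hg.const_mul (2 ^ m * ⟪g, u⟫_ℝ ^ (2 * m))⁻¹).congr ?_
  filter_upwards [hX0] with l hl
  rw [real_inner_smul_left, mul_pow, pow_mul √_, sq_sqrt (mul_nonneg zero_le_two hl), mul_pow]
  field_simp

variable [IsFiniteMeasure ρ] {F : ℝ → ℝ} {ν : ℝ}

theorem timesDifferentiableAt_mgf_iff (hX : Measurable X) (hX0 : 0 ≤ᵐ[ρ] X) (m : ℕ) :
    TimesDifferentiableAt (2 * m) (fun h => mgf X ρ (-h ^ 2)) 0 ↔
      Integrable (fun l => X l ^ m) ρ := by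
  have hchar : (fun h => mgf X ρ (-h ^ 2)) =
      fun h => (charFun (gaussianMixture ρ X ℝ) h).re := by
    ext h
    rw [charFun_gaussianMixture hX hX0, Complex.ofReal_re, Real.norm_eq_abs, sq_abs]
  rw [hchar, timesDifferentiableAt_re_charFun_iff]
  constructor <;> intro h
  · refine integrable_pow_of_integrable_inner_pow_gaussianMixture hX hX0 (one_ne_zero (α := ℝ)) ?_
    simpa using h
  · simpa [Real.norm_eq_abs, (even_two_mul m).pow_abs] using
      integrable_norm_pow_gaussianMixture (E := ℝ) hX hX0 h

variable {d : ℕ} {Ω : Type u} [MeasurableSpace Ω] {P : Measure Ω} [IsProbabilityMeasure P]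
  {Z : EuclideanSpace ℝ (Fin d) → Ω → ℝ}

lemma IsIsotropicField.hasSpectralMeasure_gaussianMixture (hX : Measurable X) (hX0 : 0 ≤ᵐ[ρ] X)
    (hF : ∀ h, 0 ≤ h → F h = mgf X ρ (-h ^ 2)) (hZ : IsIsotropicField P Z F) :
    HasSpectralMeasure (fun s => (hZ.memLp s).toLp (Z s)) (gaussianMixture ρ X _) :=
  hZ.hasSpectralMeasure fun v => by
    rw [hF _ (norm_nonneg v), charFun_gaussianMixture hX hX0, Complex.ofReal_re]

theorem IsIsotropicField.isMSDifferentiable_of_integrable_pow (hX : Measurable X)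
    (hX0 : 0 ≤ᵐ[ρ] X) (hF : ∀ h, 0 ≤ h → F h = mgf X ρ (-h ^ 2)) (hZ : IsIsotropicField P Z F)
    {m : ℕ} (hm : Integrable (fun l => X l ^ m) ρ) : IsMSDifferentiable P m Z :=
  (hZ.hasSpectralMeasure_gaussianMixture hX hX0 hF).isMSDifferentiable m hZ.memLp
    (integrable_norm_pow_gaussianMixture hX hX0 hm)

theorem IsIsotropicField.integrable_pow_of_isMSDifferentiableAlong (hX : Measurable X)
    (hX0 : 0 ≤ᵐ[ρ] X) (hF : ∀ h, 0 ≤ h → F h = mgf X ρ (-h ^ 2)) (hZ : IsIsotropicField P Z F)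
    {m : ℕ} {e : EuclideanSpace ℝ (Fin d)} (he : e ≠ 0) (h : IsMSDifferentiableAlong P e m Z) :
    Integrable (fun l => X l ^ m) ρ :=
  integrable_pow_of_integrable_inner_pow_gaussianMixture hX hX0 he
    ((hZ.hasSpectralMeasure_gaussianMixture hX hX0 hF).integrable_inner_pow m hZ.memLp h)

/-- The parameter `ν` governs the differentiability at the origin of the isotropic covariance `F` on
`ℝ^d`: the even extension of `F` is `2m` times differentiable, and a field with covariance `F` is
`m` times mean-square differentiable, exactly for `m < ν`. -/
def HasOriginSmoothness (d : ℕ) (ν : ℝ) (F : ℝ → ℝ) : Prop :=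
  (∀ m : ℕ, TimesDifferentiableAt (2 * m) (fun h : ℝ => F |h|) 0 ↔ (m : ℝ) < ν) ∧
    ∀ {Ω : Type u} [MeasurableSpace Ω] (P : Measure Ω) [IsProbabilityMeasure P]
      (Z : EuclideanSpace ℝ (Fin d) → Ω → ℝ), IsIsotropicField P Z F →
      (∀ m : ℕ, IsMSDifferentiable P m Z ↔ (m : ℝ) < ν) ∧
      (∀ (m : ℕ) (e : EuclideanSpace ℝ (Fin d)), e ≠ 0 →
        (IsMSDifferentiableAlong P e m Z ↔ (m : ℝ) < ν)) ∧
      ((∀ n : ℕ, ν ≠ n) → IsMSDifferentiable P ⌊ν⌋₊ Z ∧ ¬ IsMSDifferentiable P (⌊ν⌋₊ + 1) Z)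

theorem hasOriginSmoothness_of_eq_mgf (hd : 0 < d) (hν : 0 ≤ ν) (hX : Measurable X)
    (hX0 : 0 ≤ᵐ[ρ] X) (hF : ∀ h, 0 ≤ h → F h = mgf X ρ (-h ^ 2))
    (hm : ∀ m : ℕ, Integrable (fun l => X l ^ m) ρ ↔ (m : ℝ) < ν) :
    HasOriginSmoothness.{u} d ν F := by
  refine ⟨fun m => ?_, fun P _ Z hZ => ?_⟩
  · simp only [hF _ (abs_nonneg _), sq_abs]
    rw [timesDifferentiableAt_mgf_iff hX hX0, hm]
  · have suff : ∀ m : ℕ, (m : ℝ) < ν → IsMSDifferentiable P m Z := fun m hmν =>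
      hZ.isMSDifferentiable_of_integrable_pow hX hX0 hF ((hm m).2 hmν)
    have nec : ∀ (m : ℕ) (e : EuclideanSpace ℝ (Fin d)), e ≠ 0 →
        IsMSDifferentiableAlong P e m Z → (m : ℝ) < ν := fun m e he h =>
      (hm m).1 (hZ.integrable_pow_of_isMSDifferentiableAlong hX hX0 hF he h)
    have : Nonempty (Fin d) := ⟨⟨0, hd⟩⟩
    obtain ⟨e, he⟩ := exists_ne (0 : EuclideanSpace ℝ (Fin d))
    have iff : ∀ m : ℕ, IsMSDifferentiable P m Z ↔ (m : ℝ) < ν := fun m =>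
      ⟨fun h => nec m e he (h.along e), suff m⟩
    refine ⟨iff, fun m e he => ⟨nec m e he, fun h => (suff m h).along e⟩, fun hn => ?_⟩
    rw [iff, iff]
    push_cast
    exact ⟨(Nat.floor_le hν).lt_of_ne (hn _).symm, (Nat.lt_floor_add_one ν).not_gt⟩

theorem hasOriginSmoothness_of_eq_const_mul_mgf (hd : 0 < d) (hν : 0 ≤ ν) (hX : Measurable X)
    (hX0 : 0 ≤ᵐ[ρ] X) {c : ℝ} (hc : 0 < c) (hF : ∀ h, 0 ≤ h → F h = c * mgf X ρ (-h ^ 2))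
    (hm : ∀ m : ℕ, Integrable (fun l => X l ^ m) ρ ↔ (m : ℝ) < ν) :
    HasOriginSmoothness.{u} d ν F := by
  have : IsFiniteMeasure (ENNReal.ofReal c • ρ) := ρ.smul_finite ENNReal.ofReal_ne_top
  refine hasOriginSmoothness_of_eq_mgf (ρ := ENNReal.ofReal c • ρ) hd hν hX
    (Measure.ae_smul_measure hX0 _) (fun h hh => ?_) fun m => ?_
  · rw [hF h hh, mgf_smul_measure, ENNReal.toReal_ofReal hc.le]
  · rw [← hm, integrable_smul_measure (ENNReal.ofReal_pos.2 hc).ne' ENNReal.ofReal_ne_top]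

end GaussianMixture

/-! ### Gamma distributions -/

section GammaMeasure

variable {a r : ℝ}

lemma gammaMeasure_eq_withDensity_restrict (a r : ℝ) :
    gammaMeasure a r = (volume.restrict (Ioi 0)).withDensity
      fun x => ENNReal.ofReal (r ^ a / Gamma a * x ^ (a - 1) * exp (-(r * x))) := by
  rw [gammaMeasure, ← withDensity_indicator measurableSet_Ioi]
  refine withDensity_congr_ae ?_
  filter_upwards [compl_mem_ae_iff.2 (measure_singleton (0 : ℝ))] with x hx
  rcases lt_or_gt_of_ne (show x ≠ 0 from hx) with h | h
  · rw [gammaPDF_of_neg h, indicator_of_notMem (by simpa using h.le)]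
  · rw [gammaPDF_of_nonneg h.le, indicator_of_mem (by simpa using h)]

lemma ae_pos_gammaMeasure (a r : ℝ) : ∀ᵐ x ∂(gammaMeasure a r), 0 < x := by
  rw [gammaMeasure_eq_withDensity_restrict]
  exact (withDensity_absolutelyContinuous _ _).ae_le (ae_restrict_mem measurableSet_Ioi)

lemma gammaDensity_nonneg (ha : 0 < a) (hr : 0 < r) {x : ℝ} (hx : 0 < x) :
    0 ≤ r ^ a / Gamma a * x ^ (a - 1) * exp (-(r * x)) := by
  have := Gamma_pos_of_pos ha
  positivity

lemma integral_gammaMeasure (ha : 0 < a) (hr : 0 < r) (f : ℝ → ℝ) :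
    ∫ x, f x ∂(gammaMeasure a r) =
      ∫ x in Ioi 0, r ^ a / Gamma a * x ^ (a - 1) * exp (-(r * x)) * f x := by
  rw [gammaMeasure_eq_withDensity_restrict, integral_withDensity_eq_integral_toReal_smul
    (by fun_prop) (Eventually.of_forall fun x => ENNReal.ofReal_lt_top)]
  refine setIntegral_congr_fun measurableSet_Ioi fun x hx => ?_
  rw [ENNReal.toReal_ofReal (gammaDensity_nonneg ha hr hx), smul_eq_mul]

lemma integrable_gammaMeasure_iff (ha : 0 < a) (hr : 0 < r) (f : ℝ → ℝ) :
    Integrable f (gammaMeasure a r) ↔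
      IntegrableOn (fun x => r ^ a / Gamma a * x ^ (a - 1) * exp (-(r * x)) * f x) (Ioi 0) := by
  rw [gammaMeasure_eq_withDensity_restrict, integrable_withDensity_iff_integrable_smul'
    (by fun_prop) (Eventually.of_forall fun x => ENNReal.ofReal_lt_top), IntegrableOn]
  refine integrable_congr ?_
  filter_upwards [ae_restrict_mem measurableSet_Ioi] with x hx
  rw [ENNReal.toReal_ofReal (gammaDensity_nonneg ha hr hx), smul_eq_mul]

lemma integrableOn_rpow_mul_exp_neg_mul_Ioi_iff {s : ℝ} (hr : 0 < r) :
    IntegrableOn (fun x => x ^ s * exp (-(r * x))) (Ioi 0) ↔ -1 < s := by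
  refine ⟨fun h => ?_, fun hs => ?_⟩
  · rw [← intervalIntegral.integrableOn_Ioo_rpow_iff one_pos]
    refine ((h.mono_set Ioo_subset_Ioi_self).const_mul (exp r)).mono'
      (Measurable.aestronglyMeasurable (by fun_prop)) ?_
    filter_upwards [ae_restrict_mem measurableSet_Ioo] with x ⟨hx0, hx1⟩
    rw [norm_of_nonneg (by positivity), mul_left_comm, ← exp_add]
    exact le_mul_of_one_le_right (by positivity) (one_le_exp (by nlinarith))
  · simpa [neg_mul] using integrableOn_rpow_mul_exp_neg_mul_rpow hs one_pos hr

lemma integrable_rpow_gammaMeasure_iff (ha : 0 < a) (hr : 0 < r) {p : ℝ} :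
    Integrable (fun x => x ^ p) (gammaMeasure a r) ↔ 0 < a + p := by
  have hc : r ^ a / Gamma a ≠ 0 := by
    have := Gamma_pos_of_pos ha
    positivity
  have hdensity : EqOn (fun x => r ^ a / Gamma a * x ^ (a - 1) * exp (-(r * x)) * x ^ p)
      (fun x => r ^ a / Gamma a * (x ^ (a - 1 + p) * exp (-(r * x)))) (Ioi 0) := fun x hx => by
    simp only [rpow_add hx]
    ring
  rw [integrable_gammaMeasure_iff ha hr, integrableOn_congr_fun hdensity measurableSet_Ioi,
    IntegrableOn, integrable_const_mul_iff hc.isUnit, ← IntegrableOn,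
    integrableOn_rpow_mul_exp_neg_mul_Ioi_iff hr]
  constructor <;> intro h <;> linarith

lemma integral_rpow_gammaMeasure (ha : 0 < a) (hr : 0 < r) {p : ℝ} (hp : 0 < a + p) :
    ∫ x, x ^ p ∂(gammaMeasure a r) = Gamma (a + p) / (Gamma a * r ^ p) := by
  have := Gamma_pos_of_pos ha
  calc ∫ x, x ^ p ∂(gammaMeasure a r)
      = ∫ x in Ioi 0, r ^ a / Gamma a * (x ^ (a + p - 1) * exp (-(r * x))) := by
        rw [integral_gammaMeasure ha hr]
        refine setIntegral_congr_fun measurableSet_Ioi fun x hx => ?_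
        rw [show a + p - 1 = (a - 1) + p by ring]
        simp only [rpow_add hx]
        ring
    _ = Gamma (a + p) / (Gamma a * r ^ p) := by
        rw [integral_const_mul, integral_rpow_mul_exp_neg_mul_Ioi hp hr,
          div_rpow zero_le_one hr.le, one_rpow, rpow_add hr]
        field_simp

lemma mgf_id_gammaMeasure (ha : 0 < a) (hr : 0 < r) {t : ℝ} (ht : t < r) :
    mgf id (gammaMeasure a r) t = (r / (r - t)) ^ a := by
  have hrt : 0 < r - t := sub_pos.2 ht
  have := Gamma_pos_of_pos ha
  calc mgf id (gammaMeasure a r) t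
      = ∫ x in Ioi 0, r ^ a / Gamma a * (x ^ (a - 1) * exp (-((r - t) * x))) := by
        rw [mgf, integral_gammaMeasure ha hr]
        congr 1 with x
        rw [mul_assoc, ← exp_add, mul_assoc, id]
        ring_nf
    _ = (r / (r - t)) ^ a := by
        rw [integral_const_mul, integral_rpow_mul_exp_neg_mul_Ioi ha hrt,
          div_rpow zero_le_one hrt.le, div_rpow hr.le hrt.le, one_rpow]
        field_simp

lemma integrable_const_div_pow_gammaMeasure_iff (ha : 0 < a) (hr : 0 < r) {c : ℝ} (hc : c ≠ 0)
    (m : ℕ) : Integrable (fun x => (c / x) ^ m) (gammaMeasure a r) ↔ (m : ℝ) < a := by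
  have hpow : (fun x => (c / x) ^ m) =ᵐ[gammaMeasure a r] fun x => c ^ m * x ^ (-m : ℝ) := by
    filter_upwards [ae_pos_gammaMeasure a r] with x hx
    rw [div_pow, rpow_neg hx.le, rpow_natCast, div_eq_mul_inv]
  rw [integrable_congr hpow, integrable_const_mul_iff (pow_ne_zero m hc).isUnit,
    integrable_rpow_gammaMeasure_iff ha hr, ← sub_eq_add_neg, sub_pos]

end GammaMeasure

/-! ### Mixture representations of the covariances -/

section Covariances

variable {ν α β φ σsq h : ℝ}

lemma besselK_eq_integral (p : ℝ) {z : ℝ} (hz : 0 < z) :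
    besselK p z = (1 / 2) * (2 / z) ^ p *
      ∫ s in Ioi (0 : ℝ), s ^ (p - 1) * exp (-s) * exp (-z ^ 2 * (4 * s)⁻¹) := by
  have hb : 0 < 2 / z := by positivity
  have hsubst := integral_comp_mul_left_Ioi
    (fun x : ℝ => x ^ (p - 1) * exp (-(z * (x + 1 / x)) / 2)) 0 hb
  rw [mul_zero, smul_eq_mul, eq_inv_mul_iff_mul_eq₀ hb.ne'] at hsubst
  have hpow : (2 / z) ^ p = 2 / z * (2 / z) ^ (p - 1) := by
    rw [rpow_sub_one hb.ne', mul_div_cancel₀ _ hb.ne']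
  rw [besselK, ← hsubst, hpow, mul_assoc (1 / 2), mul_assoc (2 / z),
    ← integral_const_mul ((2 / z) ^ (p - 1))]
  congr 2
  refine setIntegral_congr_fun measurableSet_Ioi fun s hs => ?_
  have hs : 0 < s := hs
  rw [mul_rpow hb.le hs.le, mul_assoc, mul_assoc, ← exp_add]
  congr 3
  field_simp
  ring

lemma besselK_eq_mgf {p z : ℝ} (hp : 0 < p) (hz : 0 < z) :
    besselK p z = Gamma p / 2 * (2 / z) ^ p *
      mgf (fun s => (4 * s)⁻¹) (gammaMeasure p 1) (-z ^ 2) := by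
  have := Gamma_pos_of_pos hp
  rw [besselK_eq_integral p hz, mgf, integral_gammaMeasure hp one_pos]
  simp only [one_rpow, one_mul, mul_assoc, integral_const_mul]
  generalize ∫ s in Ioi (0 : ℝ), s ^ (p - 1) * (exp (-s) * exp (-z ^ 2 * (4 * s)⁻¹)) = I
  field_simp

theorem maternCov_eq_mgf (hν : 0 < ν) (hφ : 0 < φ) (hh : 0 ≤ h) :
    maternCov ν φ σsq h =
      σsq * mgf (fun s => ν / (2 * φ ^ 2) / s) (gammaMeasure ν 1) (-h ^ 2) := by
  have := Gamma_pos_of_pos hν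
  have := isProbabilityMeasure_gammaMeasure hν one_pos
  rcases hh.eq_or_lt with rfl | hh
  · simp [maternCov]
  have hz : 0 < √(2 * ν) / φ * h := by positivity
  have hmgf : mgf (fun s => (4 * s)⁻¹) (gammaMeasure ν 1) (-(√(2 * ν) / φ * h) ^ 2) =
      mgf (fun s => ν / (2 * φ ^ 2) / s) (gammaMeasure ν 1) (-h ^ 2) := by
    refine integral_congr_ae (Eventually.of_forall fun s => congrArg exp ?_)
    rw [mul_pow, div_pow, sq_sqrt (by positivity)]
    ring
  rw [maternCov, if_neg hh.ne', besselK_eq_mgf hν hz, hmgf, rpow_sub two_pos, rpow_one,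
    div_rpow two_pos.le hz.le]
  field_simp

lemma setIntegral_mul_invGammaDensity {a b : ℝ} (ha : 0 < a) (hb : 0 < b) (f : ℝ → ℝ) :
    ∫ v in Ioi (0 : ℝ), f v * invGammaDensity a b v = ∫ x, f x⁻¹ ∂(gammaMeasure a b) := by
  rw [integral_gammaMeasure ha hb, ← integral_comp_rpow_Ioi _ (p := -1) (by norm_num)]
  refine setIntegral_congr_fun measurableSet_Ioi fun x hx => ?_
  have hx : 0 < x := hx
  have hpow : x ^ (-1 - 1 : ℝ) * x⁻¹ ^ (-a - 1) = x ^ (a - 1) := by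
    rw [← rpow_neg_one x, ← rpow_mul hx.le, ← rpow_add hx]
    ring_nf
  simp only [invGammaDensity, smul_eq_mul, rpow_neg_one, abs_neg, abs_one, one_mul]
  rw [← hpow, div_inv_eq_mul, neg_mul]
  ring

lemma chCov_eq_integral_mgf (hν : 0 < ν) (hα : 0 < α) (hβ : 0 < β) (hh : 0 ≤ h) :
    chCov ν α β σsq h = σsq * ∫ x, mgf (fun s => ν / 2 * x / s) (gammaMeasure ν 1) (-h ^ 2)
      ∂(gammaMeasure α (β ^ 2 / 2)) := by
  rw [chCov, setIntegral_mul_invGammaDensity hα (by positivity) fun v => maternCov ν (√v) σsq h,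
    ← integral_const_mul]
  refine integral_congr_ae ?_
  filter_upwards [ae_pos_gammaMeasure α (β ^ 2 / 2)] with x hx
  rw [maternCov_eq_mgf hν (by positivity) hh, sq_sqrt (by positivity), ← div_div, div_inv_eq_mul]

lemma ae_nonneg_chMixing (hν : 0 ≤ ν) (a b c r : ℝ) :
    0 ≤ᵐ[(gammaMeasure a b).prod (gammaMeasure c r)] fun p => ν / 2 * p.1 / p.2 := by
  filter_upwards [Measure.quasiMeasurePreserving_fst.ae (ae_pos_gammaMeasure a b),
    Measure.quasiMeasurePreserving_snd.ae (ae_pos_gammaMeasure c r)] with p h1 h2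
  simp only [Pi.zero_apply]
  positivity

theorem chCov_eq_mgf (hν : 0 < ν) (hα : 0 < α) (hβ : 0 < β) (hh : 0 ≤ h) :
    chCov ν α β σsq h = σsq * mgf (fun p : ℝ × ℝ => ν / 2 * p.1 / p.2)
      ((gammaMeasure α (β ^ 2 / 2)).prod (gammaMeasure ν 1)) (-h ^ 2) := by
  have := isProbabilityMeasure_gammaMeasure hν one_pos
  have := isProbabilityMeasure_gammaMeasure hα (show 0 < β ^ 2 / 2 by positivity)
  rw [chCov_eq_integral_mgf hν hα hβ hh, mgf, integral_prod]
  · rfl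
  · exact integrable_exp_mul_of_nonpos_of_nonneg (by fun_prop) (ae_nonneg_chMixing hν.le ..)
      (neg_nonpos.2 (sq_nonneg h))

lemma integrable_chMixing_pow_iff (hν : 0 < ν) (hα : 0 < α) (hβ : 0 < β) (m : ℕ) :
    Integrable (fun p : ℝ × ℝ => (ν / 2 * p.1 / p.2) ^ m)
      ((gammaMeasure α (β ^ 2 / 2)).prod (gammaMeasure ν 1)) ↔ (m : ℝ) < ν := by
  have hb : 0 < β ^ 2 / 2 := by positivity
  have := isProbabilityMeasure_gammaMeasure hν one_pos
  have := isProbabilityMeasure_gammaMeasure hα hb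
  constructor <;> intro h
  · obtain ⟨x, hx, hx0⟩ := (h.prod_right_ae.and (ae_pos_gammaMeasure α (β ^ 2 / 2))).exists
    exact (integrable_const_div_pow_gammaMeasure_iff hν one_pos
      (mul_pos (half_pos hν) hx0).ne' m).1 hx
  · have h1 : Integrable (fun x : ℝ => x ^ m) (gammaMeasure α (β ^ 2 / 2)) := by
      simpa using (integrable_rpow_gammaMeasure_iff hα hb (p := m)).2 (by positivity)
    refine (h1.mul_prod ((integrable_const_div_pow_gammaMeasure_iff hν one_pos
      (half_pos hν).ne' m).2 h)).congr (Eventually.of_forall fun p => ?_)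
    simp only [div_pow, mul_pow]
    ring

end Covariances

/-! ### Slow variation and tail behavior -/

section Tail

variable {ν α β σsq h : ℝ}

lemma tendsto_div_add_mul_atTop (b : ℝ) {x : ℝ} (hx : x ≠ 0) :
    Tendsto (fun t => t / (b + t * x)) atTop (𝓝 x⁻¹) := by
  have hlim : Tendsto (fun t => (b * t⁻¹ + x)⁻¹) atTop (𝓝 (b * 0 + x)⁻¹) :=
    ((tendsto_inv_atTop_zero.const_mul b).add_const x).inv₀ (by simpa)
  rw [mul_zero, zero_add] at hlim
  refine hlim.congr' ?_
  filter_upwards [eventually_gt_atTop 0] with t ht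
  field_simp

theorem isSlowlyVarying_of_tendsto {L : ℝ → ℝ} {c : ℝ} (hc : 0 < c) (hL : Measurable L)
    (hlim : Tendsto L atTop (𝓝 c)) : IsSlowlyVarying L := by
  obtain ⟨a, ha⟩ := eventually_atTop.1 (hlim.eventually_const_lt hc)
  refine ⟨⟨a, ha, hL.comp measurable_subtype_coe⟩, fun t ht => ?_⟩
  have h := (hlim.comp (tendsto_id.const_mul_atTop ht)).div hlim hc.ne'
  rwa [div_self hc.ne'] at h

lemma tendsto_chSlow (hνα : 0 ≤ ν + α) : Tendsto (chSlow ν α β) atTop (𝓝 1) := by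
  have hlim := (tendsto_div_add_mul_atTop (β ^ 2 / (2 * ν)) one_ne_zero).rpow_const
    (p := ν + α) (Or.inr hνα)
  simp only [mul_one, inv_one, one_rpow, add_comm (β ^ 2 / (2 * ν))] at hlim
  exact hlim

theorem isSlowlyVarying_chSlow (hνα : 0 ≤ ν + α) : IsSlowlyVarying (chSlow ν α β) :=
  isSlowlyVarying_of_tendsto one_pos (by unfold chSlow; fun_prop) (tendsto_chSlow hνα)

/-- Dominated convergence: multiplied by `t ^ α`, the integrand increases to its limit. -/
lemma tendsto_rpow_mul_integral_div_add_rpow {Λ : Type*} [MeasurableSpace Λ] {ρ : Measure Λ}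
    {X : Λ → ℝ} {b : ℝ} (hb : 0 ≤ b) (hα : 0 ≤ α) (hX : AEMeasurable X ρ) (hX0 : ∀ᵐ l ∂ρ, 0 < X l)
    (hint : Integrable (fun l => (b / X l) ^ α) ρ) :
    Tendsto (fun t => t ^ α * ∫ l, (b / (b + t * X l)) ^ α ∂ρ) atTop
      (𝓝 (∫ l, (b / X l) ^ α ∂ρ)) := by
  have hscale : (fun t => t ^ α * ∫ l, (b / (b + t * X l)) ^ α ∂ρ) =ᶠ[atTop]
      fun t => ∫ l, (b * (t / (b + t * X l))) ^ α ∂ρ := by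
    filter_upwards [eventually_gt_atTop 0] with t ht
    rw [← integral_const_mul]
    refine integral_congr_ae ?_
    filter_upwards [hX0] with l hl
    rw [← mul_rpow ht.le (by positivity), mul_div_left_comm]
  refine (tendsto_congr' hscale).2 (tendsto_integral_filter_of_dominated_convergence _
    (Eventually.of_forall fun t => AEMeasurable.aestronglyMeasurable (by fun_prop)) ?_ hint ?_)
  · filter_upwards [eventually_gt_atTop 0] with t ht
    filter_upwards [hX0] with l hl
    rw [norm_of_nonneg (by positivity), div_eq_mul_inv b]
    gcongr
    rw [div_le_iff₀ (by positivity)]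
    field_simp
    linarith
  · filter_upwards [hX0] with l hl
    exact ((tendsto_div_add_mul_atTop b hl.ne').const_mul b).rpow_const (Or.inr hα)

lemma chCov_eq_integral_rpow (hν : 0 < ν) (hα : 0 < α) (hβ : 0 < β) (hh : 0 ≤ h) :
    chCov ν α β σsq h = σsq * ∫ s, (β ^ 2 / 2 / (β ^ 2 / 2 + h ^ 2 * (ν / 2 / s))) ^ α
      ∂(gammaMeasure ν 1) := by
  have hb : 0 < β ^ 2 / 2 := by positivity
  have := isProbabilityMeasure_gammaMeasure hν one_pos
  have := isProbabilityMeasure_gammaMeasure hα hb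
  rw [chCov_eq_mgf hν hα hβ hh, mgf, integral_prod_symm _
    (integrable_exp_mul_of_nonpos_of_nonneg (by fun_prop) (ae_nonneg_chMixing hν.le ..)
      (neg_nonpos.2 (sq_nonneg h)))]
  congr 1
  refine integral_congr_ae ?_
  filter_upwards [ae_pos_gammaMeasure ν 1] with s hs
  have ht : 0 ≤ h ^ 2 * (ν / 2 / s) := by positivity
  have hmgf := mgf_id_gammaMeasure hα hb ((neg_nonpos.2 ht).trans_lt hb)
  rw [sub_neg_eq_add] at hmgf
  rw [← hmgf]
  refine integral_congr_ae (Eventually.of_forall fun x => congrArg exp ?_)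
  simp only [id]
  ring

theorem tendsto_rpow_mul_chCov (hν : 0 < ν) (hα : 0 < α) (hβ : 0 < β) :
    Tendsto (fun h => h ^ (2 * α) * chCov ν α β σsq h) atTop
      (𝓝 (σsq * β ^ (2 * α) * Gamma (ν + α) / (ν ^ α * Gamma ν))) := by
  have hmoment : (fun s => (β ^ 2 / 2 / (ν / 2 / s)) ^ α) =ᵐ[gammaMeasure ν 1]
      fun s => β ^ (2 * α) / ν ^ α * s ^ α := by
    filter_upwards [ae_pos_gammaMeasure ν 1] with s hs
    rw [rpow_mul hβ.le, rpow_two, ← div_rpow (by positivity) hν.le,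
      ← mul_rpow (by positivity) hs.le]
    congr 1
    field_simp
  have hlim := tendsto_rpow_mul_integral_div_add_rpow (ρ := gammaMeasure ν 1)
    (X := fun s => ν / 2 / s) (b := β ^ 2 / 2) (by positivity) hα.le (by fun_prop)
    ((ae_pos_gammaMeasure ν 1).mono fun s hs => by positivity) <|
    (integrable_congr hmoment).2 <|
      ((integrable_rpow_gammaMeasure_iff hν one_pos).2 (add_pos hν hα)).const_mul _
  rw [integral_congr_ae hmoment, integral_const_mul,
    integral_rpow_gammaMeasure hν one_pos (add_pos hν hα)] at hlim
  have hlim' := (hlim.comp (tendsto_pow_atTop two_ne_zero)).const_mul σsq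
  convert! hlim'.congr' ?_ using 2
  · rw [one_rpow]
    field_simp
  · filter_upwards [eventually_ge_atTop 0] with h hh
    rw [chCov_eq_integral_rpow hν hα hβ hh, rpow_mul hh, rpow_two, mul_left_comm]
    rfl

theorem isEquivalent_chCov (hν : 0 < ν) (hα : 0 < α) (hβ : 0 < β) (hσ : 0 < σsq) :
    (fun h : ℝ => chCov ν α β σsq h) ~[atTop]
      (fun h : ℝ => σsq * β ^ (2 * α) * Gamma (ν + α) / (ν ^ α * Gamma ν) *
        |h| ^ (-(2 * α)) * chSlow ν α β (h ^ 2)) := by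
  have hC := tendsto_rpow_mul_chCov (σsq := σsq) hν hα hβ
  set K := σsq * β ^ (2 * α) * Gamma (ν + α) / (ν ^ α * Gamma ν)
  have hK0 : K ≠ 0 := by
    have := Gamma_pos_of_pos hν
    have := Gamma_pos_of_pos (add_pos hν hα)
    positivity
  have hL : Tendsto (fun h : ℝ => K * chSlow ν α β (h ^ 2)) atTop (𝓝 K) := by
    simpa using ((tendsto_chSlow (add_pos hν hα).le).comp
      (tendsto_pow_atTop two_ne_zero)).const_mul K
  have hratio := hC.div hL hK0
  rw [div_self hK0] at hratio
  refine isEquivalent_of_tendsto_one (hratio.congr' ?_)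
  filter_upwards [eventually_gt_atTop 0] with h hh
  simp only [Pi.div_apply]
  rw [abs_of_pos hh, rpow_neg hh.le, mul_right_comm K, ← div_eq_mul_inv, div_div_eq_mul_div,
    mul_comm (h ^ (2 * α))]

end Tail

/-! ### Smoothness at the origin -/

theorem hasOriginSmoothness_maternCov {d : ℕ} {ν φ τsq : ℝ} (hd : 0 < d) (hν : 0 < ν) (hφ : 0 < φ)
    (hτ : 0 < τsq) : HasOriginSmoothness.{u} d ν (maternCov ν φ τsq) := by
  have := isProbabilityMeasure_gammaMeasure hν one_pos
  exact hasOriginSmoothness_of_eq_const_mul_mgf hd hν.le (by fun_prop)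
    ((ae_pos_gammaMeasure ν 1).mono fun s hs => by simp only [Pi.zero_apply]; positivity) hτ
    (fun h hh => maternCov_eq_mgf hν hφ hh)
    (integrable_const_div_pow_gammaMeasure_iff hν one_pos (by positivity))

theorem hasOriginSmoothness_chCov {d : ℕ} {ν α β σsq : ℝ} (hd : 0 < d) (hν : 0 < ν) (hα : 0 < α)
    (hβ : 0 < β) (hσ : 0 < σsq) : HasOriginSmoothness.{u} d ν (chCov ν α β σsq) := by
  have := isProbabilityMeasure_gammaMeasure hν one_pos
  have := isProbabilityMeasure_gammaMeasure hα (show 0 < β ^ 2 / 2 by positivity)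
  exact hasOriginSmoothness_of_eq_const_mul_mgf hd hν.le (by fun_prop)
    (ae_nonneg_chMixing hν.le ..) hσ (fun h hh => chCov_eq_mgf hν hα hβ hh)
    (integrable_chMixing_pow_iff hν hα hβ)

theorem theorem2 (d : ℕ) (hd : 0 < d) (ν α β σsq : ℝ)
    (hν : 0 < ν) (hα : 0 < α) (hβ : 0 < β) (hσ : 0 < σsq) :
    -- (a) origin behavior: the CH covariance, and the fields that have it
    ((∀ m : ℕ,
        TimesDifferentiableAt (2 * m) (fun h : ℝ => chCov ν α β σsq |h|) 0 ↔ (m : ℝ) < ν) ∧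
      (∀ {Ω : Type u} [MeasurableSpace Ω] (P : Measure Ω) [IsProbabilityMeasure P]
        (Z : EuclideanSpace ℝ (Fin d) → Ω → ℝ), IsIsotropicField P Z (chCov ν α β σsq) →
        (∀ m : ℕ, IsMSDifferentiable P m Z ↔ (m : ℝ) < ν) ∧
        (∀ (m : ℕ) (e : EuclideanSpace ℝ (Fin d)), e ≠ 0 →
          (IsMSDifferentiableAlong P e m Z ↔ (m : ℝ) < ν)) ∧
        ((∀ n : ℕ, ν ≠ n) →
          IsMSDifferentiable P ⌊ν⌋₊ Z ∧ ¬ IsMSDifferentiable P (⌊ν⌋₊ + 1) Z)) ∧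
      -- the same for every Matérn covariance with the same smoothness `ν`
      (∀ φ τsq : ℝ, 0 < φ → 0 < τsq →
        (∀ m : ℕ,
          TimesDifferentiableAt (2 * m) (fun h : ℝ => maternCov ν φ τsq |h|) 0 ↔ (m : ℝ) < ν) ∧
        (∀ {Ω : Type u} [MeasurableSpace Ω] (P : Measure Ω) [IsProbabilityMeasure P]
          (Z : EuclideanSpace ℝ (Fin d) → Ω → ℝ), IsIsotropicField P Z (maternCov ν φ τsq) →
          (∀ m : ℕ, IsMSDifferentiable P m Z ↔ (m : ℝ) < ν) ∧
          (∀ (m : ℕ) (e : EuclideanSpace ℝ (Fin d)), e ≠ 0 →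
            (IsMSDifferentiableAlong P e m Z ↔ (m : ℝ) < ν)) ∧
          ((∀ n : ℕ, ν ≠ n) →
            IsMSDifferentiable P ⌊ν⌋₊ Z ∧ ¬ IsMSDifferentiable P (⌊ν⌋₊ + 1) Z)))) ∧
    -- (b) tail behavior
    (IsSlowlyVarying (chSlow ν α β) ∧
      (fun h : ℝ => chCov ν α β σsq h) ~[atTop]
        (fun h : ℝ => σsq * β ^ (2 * α) * Gamma (ν + α) / (ν ^ α * Gamma ν) *
          |h| ^ (-(2 * α)) * chSlow ν α β (h ^ 2))) := by
  exact ⟨and_assoc.1 ⟨hasOriginSmoothness_chCov hd hν hα hβ hσ,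
      fun φ τsq hφ hτ => hasOriginSmoothness_maternCov hd hν hφ hτ⟩,
    isSlowlyVarying_chSlow (add_pos hν hα).le, isEquivalent_chCov hν hα hβ hσ⟩
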